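/- Let $r\ge 1$. For a family $z=(z_{im})$ of complex numbers indexed by $1\le i\le r$, $m\ge 1$, put $z_{0m}=z_{r+1,m}=1$ and $z_{i0}=1$. Let $S(A_r,A_{\mathbb N})$ be the Zariski closure, in the affine space of all such families, of the set of those solutions of $$z_{i-1,m}\,z_{i+1,m}+z_{i,m-1}\,z_{i,m+1}=z_{im}^2\qquad(1\le i\le r,\ m\ge 1)$$ for which no component $z_{im}$ vanishes. Let $z\in S(A_r,A_{\mathbb N})$, and put $x_i=z_{i1}$ for $1\le i\le r$ and $x_0=x_{r+1}=1$. Let $g_1,\ldots,g_{r+1}$ be the roots (with multiplicity, in any order) of the polynomial $$p(\gamma)=\sum_{k=0}^{r+1}(-1)^k x_{r+1-k}\gamma^k,$$ and put $g=\mathrm{diag}(g_1,\ldots,g_{r+1})$. Then $g\in SL(r+1,\mathbb C)$, and for every integer $m\ge 0$ one has $$z_{1m}=\chi_{m\lambda_1}(g),$$ where $\lambda_1(\mathrm{diag}(t_1,\ldots,t_{r+1}))=t_1$ is the first fundamental weight and $\chi_{m\lambda_1}$ is the character of the irreducible finite-dimensional algebraic representation of $SL(r+1,\mathbb C)$ with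 highest weight $m\lambda_1$; that is, such a representation exists, and for every such representation $\rho$ one has $z_{1m}=\operatorname{tr}\rho(g)$. -/

import Mathlib

open scoped Matrix

noncomputable section

namespace HirotaA

/-! ### The discrete Hirota equations with `X = A_r`, `Y = A_ℕ` -/

/-- The vertices `(i, m)` with `1 ≤ i ≤ r` (nodes of `A_r`) and `1 ≤ m` (nodes of `A_ℕ`). -/
abbrev Vert (r : ℕ) : Type :=
  {p : ℕ × ℕ // 1 ≤ p.1 ∧ p.1 ≤ r ∧ 1 ≤ p.2}

/-- The component `z_{im}` of `z`, with the boundary convention that it equals `1` when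
`(i, m)` is not a vertex (in use for `i = 0`, `i = r + 1` and `m = 0`). -/
def comp {r : ℕ} (z : Vert r → ℂ) (i m : ℕ) : ℂ :=
  if h : 1 ≤ i ∧ i ≤ r ∧ 1 ≤ m then z ⟨(i, m), h⟩ else 1

/-- The equations `z^{(2 - C(A_r)) ⊗ I} + z^{I ⊗ (2 - C(A_ℕ))} = z^2`: the first monomial is the
product over the neighbours in `A_r`, the second one the product over the neighbours in `A_ℕ`. -/
def IsSolution {r : ℕ} (z : Vert r → ℂ) : Prop :=
  ∀ i m : ℕ, 1 ≤ i → i ≤ r → 1 ≤ m →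
    comp z (i - 1) m * comp z (i + 1) m + comp z i (m - 1) * comp z i (m + 1) = comp z i m ^ 2

/-- The variety `S(A_r, A_ℕ)`: the Zariski closure of the set of those solutions
for which no component vanishes. -/
def S (r : ℕ) : Set (Vert r → ℂ) :=
  MvPolynomial.zeroLocus ℂ
    (MvPolynomial.vanishingIdeal ℂ {z : Vert r → ℂ | IsSolution z ∧ ∀ v, z v ≠ 0})

/-- The polynomial `p(γ) = ∑_{k=0}^{r+1} (-1)^k x_{r+1-k} γ^k` with `x_i = z_{i1}` for
`1 ≤ i ≤ r` and `x_0 = x_{r+1} = 1`. -/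
def charPoly {r : ℕ} (z : Vert r → ℂ) : Polynomial ℂ :=
  ∑ k ∈ Finset.range (r + 2),
    Polynomial.C ((-1) ^ k * comp z (r + 1 - k) 1) * Polynomial.X ^ k

/-! ### Highest weight representations of `SL(r+1, ℂ)` -/

/-- The group `SL(r+1, ℂ)`. -/
abbrev SLr (r : ℕ) : Type := Matrix.SpecialLinearGroup (Fin (r + 1)) ℂ

/-- The fundamental weight `λ_i`, `λ_i(diag(t_1, …, t_{r+1})) = t_1 ⋯ t_i`
(here `t_1, …, t_{r+1}` are `t 0, …, t r`). -/
def fundWeight (r i : ℕ) (t : Fin (r + 1) → ℂ) : ℂ :=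
  ∏ j : Fin (r + 1), if (j : ℕ) < i then t j else 1

variable {r : ℕ} {V : Type*} [AddCommGroup V] [Module ℂ V]

/-- The representation is algebraic (rational): all its matrix coefficients are polynomial functions
of the entries of `g ∈ SL(r+1, ℂ)`. -/
def IsAlgebraicRep (ρ : Representation ℂ (SLr r) V) : Prop :=
  ∀ (φ : Module.Dual ℂ V) (v : V), ∃ P : MvPolynomial (Fin (r + 1) × Fin (r + 1)) ℂ,
    ∀ g : SLr r, φ (ρ g v) = MvPolynomial.eval (fun ij => g.1 ij.1 ij.2) P

/-- `Λ` is the weight of a highest weight vector: there is a nonzero vector which is fixed by all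
upper unitriangular matrices and on which each diagonal matrix `diag(t)` acts by `Λ(t)`. -/
def HasHighestWeight (ρ : Representation ℂ (SLr r) V) (Λ : (Fin (r + 1) → ℂ) → ℂ) : Prop :=
  ∃ v : V, v ≠ 0 ∧
    (∀ u : SLr r, (∀ i, u.1 i i = 1) → (∀ i j, j < i → u.1 i j = 0) → ρ u v = v) ∧
    (∀ (t : Fin (r + 1) → ℂ) (ht : (Matrix.diagonal t).det = 1),
      ρ (⟨Matrix.diagonal t, ht⟩ : SLr r) v = Λ t • v)

/-- `ρ` is a finite-dimensional irreducible algebraic representation with highest weight `Λ`. -/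
structure IsIrrepOfHighestWeight (ρ : Representation ℂ (SLr r) V)
    (Λ : (Fin (r + 1) → ℂ) → ℂ) : Prop where
  finiteDimensional : FiniteDimensional ℂ V
  irreducible : ρ.IsIrreducible
  algebraic : IsAlgebraicRep ρ
  highestWeight : HasHighestWeight ρ Λ

end HirotaA

end

/-!
The equations determine a solution without vanishing components from its initial row
`x_i = z_{i1}`, one column at a time. The Toeplitz determinants `det (x_{i-a+b})` of size `m × m`
satisfy the same equations by the Desnanot–Jacobi identity (`det_mul_det_interior`), where the
minor obtained by deleting the first and last rows and columns is `z_{i,m-1} ≠ 0`; they have the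
same boundary values, since they are unitriangular for `i = 0` and `i = r + 1`. So they are the
solution. The formula for `z_{1m}` is a polynomial identity, and therefore holds on the Zariski
closure (`comp_one_eq_det_toeplitz`).

The Toeplitz determinants with `i = 1` are the coefficients of the power series inverse to
`∑ (-1)^k x_k t^k = ∏ (1 - g_i t)`, that is, the complete homogeneous symmetric functions `h_m(g)`
(`comp_one_eq_hsum`). These are the traces of `diag(g)` on the forms of degree `m`
(`character_symPow`).

The symmetric power is irreducible: an `SL(r+1, ℂ)`-stable subspace is stable under all matrices by
Zariski density; matrices of rank one carry any nonzero form to a multiple of `X_0 ^ m`, and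
`X_0 ^ m` to every `m`-th power of a linear form, and these powers span (`isIrreducible_symPow`).

Uniqueness of the irreducible representation with highest weight `m λ_1` rests on matrix
coefficients. If `v` is a highest weight vector, let `l` be the functional with `l v = 1` that
factors through the projection to the weight space of `v` under a regular one-parameter torus. Then
`l (ρ g v) = g_{11}^m` on the big cell (lower unitriangular times diagonal times upper
unitriangular), hence everywhere (`exists_functional_matrixCoeff`). An irreducible representation is
isomorphic to the span of the translates of any of its nonzero matrix coefficients, so the character
is determined (`character_eq_of_matrixCoeff_eq`).
-/

noncomputable section

namespace HirotaA

/-! ### Toeplitz determinants and the Hirota equations -/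

section Determinants

/-- `Fin n ⊕ Unit ≃ Fin (n + 1)` with the extra point put first. -/
def sumUnitEquivFirst (n : ℕ) : Fin n ⊕ Unit ≃ Fin (n + 1) :=
  Equiv.ofBijective (Sum.elim Fin.succ fun _ => 0) <| by
    rw [Fintype.bijective_iff_injective_and_card]
    refine ⟨Function.Injective.sumElim (Fin.succ_injective n) (fun _ _ _ => rfl)
      (fun a _ => Fin.succ_ne_zero a), by simp⟩

/-- `Fin n ⊕ Unit ≃ Fin (n + 1)` with the extra point put last. -/
def sumUnitEquivLast (n : ℕ) : Fin n ⊕ Unit ≃ Fin (n + 1) :=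
  Equiv.ofBijective (Sum.elim Fin.castSucc fun _ => Fin.last n) <| by
    rw [Fintype.bijective_iff_injective_and_card]
    refine ⟨Function.Injective.sumElim (Fin.castSucc_injective n) (fun _ _ _ => rfl)
      (fun a _ => (Fin.castSucc_lt_last a).ne), by simp⟩

/-- `Fin n ⊕ Fin 2 ≃ Fin (n + 2)` with the two extra points put at the two ends. -/
def sumFinTwoEquivEnds (n : ℕ) : Fin n ⊕ Fin 2 ≃ Fin (n + 2) :=
  Equiv.ofBijective (Sum.elim (fun k => k.succ.castSucc) ![0, Fin.last (n + 1)]) <| by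
    rw [Fintype.bijective_iff_injective_and_card]
    refine ⟨Function.Injective.sumElim
      ((Fin.castSucc_injective _).comp (Fin.succ_injective n)) ?_ ?_, by simp⟩
    · intro a b
      fin_cases a <;> fin_cases b <;> simp [Fin.ext_iff]
    · intro a b
      fin_cases b
      · simp [Fin.ext_iff]
      · have := a.2
        simp [Fin.ext_iff]
        omega

variable {R : Type*} [CommRing R]

/-- Reindexing the rows and columns of one matrix by `e`, `f` and of another by `f`, `e` introduces
the same sign twice. -/
theorem det_submatrix_mul_det_submatrix {m n : Type*} [Fintype m] [DecidableEq m] [Fintype n]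
    [DecidableEq n] (A B : Matrix n n R) (e f : m ≃ n) :
    (A.submatrix e f).det * (B.submatrix f e).det = A.det * B.det := by
  rw [← Matrix.det_mul, Matrix.submatrix_mul_equiv, Matrix.det_submatrix_equiv_self,
    Matrix.det_mul]

/-- The **Desnanot–Jacobi identity** for a square matrix whose interior is invertible. Both sides
are computed by Schur complements with respect to the interior. -/
theorem det_mul_det_interior {n : ℕ} (M : Matrix (Fin (n + 2)) (Fin (n + 2)) R)
    (h : IsUnit (M.submatrix (fun k : Fin n => k.succ.castSucc)
      (fun k : Fin n => k.succ.castSucc)).det) :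
    M.det * (M.submatrix (fun k : Fin n => k.succ.castSucc)
        (fun k : Fin n => k.succ.castSucc)).det =
      (M.submatrix Fin.castSucc Fin.castSucc).det * (M.submatrix Fin.succ Fin.succ).det -
      (M.submatrix Fin.succ Fin.castSucc).det * (M.submatrix Fin.castSucc Fin.succ).det := by
  set B := M.submatrix (fun k : Fin n => k.succ.castSucc) (fun k : Fin n => k.succ.castSucc)
    with hB
  have : Invertible B := Matrix.invertibleOfIsUnitDet B h
  -- the entries of the Schur complement of the interior
  let s : Fin (n + 2) → Fin (n + 2) → R := fun p q =>
    M p q - ∑ k, (∑ j : Fin n, M p j.succ.castSucc * (⅟B) j k) * M k.succ.castSucc q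
  have hM : M.det = B.det * (s 0 0 * s (Fin.last _) (Fin.last _) -
      s 0 (Fin.last _) * s (Fin.last _) 0) := by
    rw [← Matrix.det_submatrix_equiv_self (sumFinTwoEquivEnds n) M,
      ← Matrix.fromBlocks_toBlocks (M.submatrix _ _),
      show (M.submatrix (sumFinTwoEquivEnds n) (sumFinTwoEquivEnds n)).toBlocks₁₁ = B from rfl,
      Matrix.det_fromBlocks₁₁, Matrix.det_fin_two]
    rfl
  have hs : ∀ (u w : Fin (n + 1) → Fin (n + 2)) (e f : Fin n ⊕ Unit ≃ Fin (n + 1)),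
      (∀ k, u (e (Sum.inl k)) = k.succ.castSucc) → (∀ k, w (f (Sum.inl k)) = k.succ.castSucc) →
      ((M.submatrix u w).submatrix e f).det =
        B.det * s (u (e (Sum.inr ()))) (w (f (Sum.inr ()))) := by
    intro u w e f hu hw
    have h11 : ((M.submatrix u w).submatrix e f).toBlocks₁₁ = B := by
      ext i j; simp [Matrix.toBlocks₁₁, hu, hw, hB]
    rw [← Matrix.fromBlocks_toBlocks ((M.submatrix u w).submatrix e f), h11,
      Matrix.det_fromBlocks₁₁, Matrix.det_unique (n := Unit)]
    simp only [s, Matrix.sub_apply, Matrix.mul_apply, Matrix.toBlocks₁₂, Matrix.toBlocks₂₁,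
      Matrix.toBlocks₂₂, Matrix.of_apply, Matrix.submatrix_apply, hu, hw]
  have e0 : ∀ k, Fin.castSucc (sumUnitEquivFirst n (Sum.inl k)) = k.succ.castSucc :=
    fun _ => rfl
  have e1 : ∀ k, Fin.succ (sumUnitEquivLast n (Sum.inl k)) = k.succ.castSucc :=
    fun _ => rfl
  rw [← Matrix.det_submatrix_equiv_self (sumUnitEquivFirst n) (M.submatrix _ Fin.castSucc),
    ← Matrix.det_submatrix_equiv_self (sumUnitEquivLast n) (M.submatrix Fin.succ _),
    ← det_submatrix_mul_det_submatrix (M.submatrix Fin.succ Fin.castSucc) _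
      (sumUnitEquivLast n) (sumUnitEquivFirst n),
    hs _ _ _ _ e0 e0, hs _ _ _ _ e1 e1, hs _ _ _ _ e1 e0, hs _ _ _ _ e0 e1, hM]
  simp only [show Fin.castSucc (sumUnitEquivFirst n (Sum.inr ())) = 0 from rfl,
    show Fin.succ (sumUnitEquivLast n (Sum.inr ())) = Fin.last (n + 1) from rfl]
  ring

/-- The `m × m` Toeplitz matrix with entries `x_{i - a + b}`, where `x_k = 0` for `k < 0`. -/
def toeplitz (x : ℕ → R) (i m : ℕ) : Matrix (Fin m) (Fin m) R :=
  Matrix.of fun a b => if (a : ℕ) ≤ i + b then x (i + b - a) else 0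

theorem det_toeplitz_zero {x : ℕ → R} (h0 : x 0 = 1) (m : ℕ) : (toeplitz x 0 m).det = 1 := by
  rw [Matrix.det_of_isUpperTriangular]
  · simp [toeplitz, h0]
  · intro a b hab
    have : (b : ℕ) < a := hab
    simp [toeplitz]
    omega

theorem det_toeplitz_of_vanishing {x : ℕ → R} {n : ℕ} (hn : x n = 1) (h : ∀ k, n < k → x k = 0)
    (m : ℕ) : (toeplitz x n m).det = 1 := by
  rw [Matrix.det_of_isLowerTriangular]
  · simp [toeplitz, hn]
  · intro a b hab
    have : (a : ℕ) < b := hab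
    simp only [toeplitz, Matrix.of_apply]
    rw [if_pos (by omega), h _ (by omega)]

/-- The Toeplitz determinants satisfy the equations of `IsSolution`. -/
theorem det_toeplitz_mul_det_toeplitz (x : ℕ → R) {i : ℕ} (hi : 1 ≤ i) (m : ℕ)
    (h : IsUnit (toeplitz x i m).det) :
    (toeplitz x i (m + 2)).det * (toeplitz x i m).det =
      (toeplitz x i (m + 1)).det ^ 2 -
      (toeplitz x (i - 1) (m + 1)).det * (toeplitz x (i + 1) (m + 1)).det := by
  have key : ∀ (j k : ℕ) (u w : Fin k → Fin (m + 2)),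
      (∀ a b, (w b : ℕ) + i + a = u a + j + b) →
      (toeplitz x i (m + 2)).submatrix u w = toeplitz x j k := by
    intro j k u w huw
    ext a b
    have := huw a b
    simp only [toeplitz, Matrix.submatrix_apply, Matrix.of_apply]
    by_cases hab : (a : ℕ) ≤ j + b
    · rw [if_pos hab, if_pos (by omega)]
      congr 1
      omega
    · rw [if_neg hab, if_neg (by omega)]
  have hi0 := key i m (fun k => k.succ.castSucc) (fun k => k.succ.castSucc)
    (by intro a b; simp; omega)
  have h1 := det_mul_det_interior (toeplitz x i (m + 2)) (by rw [hi0]; exact h)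
  rw [hi0, key i (m + 1) Fin.castSucc Fin.castSucc (by intro a b; simp; omega),
    key i (m + 1) Fin.succ Fin.succ (by intro a b; simp; omega),
    key (i - 1) (m + 1) Fin.succ Fin.castSucc (by intro a b; simp; omega),
    key (i + 1) (m + 1) Fin.castSucc Fin.succ (by intro a b; simp; omega)] at h1
  rw [h1]
  ring

theorem map_det_toeplitz {R' : Type*} [CommRing R'] (f : R →+* R') (x : ℕ → R) (i m : ℕ) :
    f (toeplitz x i m).det = (toeplitz (fun k => f (x k)) i m).det := by
  rw [RingHom.map_det]
  congr 1
  ext a b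
  simp only [toeplitz, RingHom.mapMatrix_apply, Matrix.map_apply, Matrix.of_apply]
  split_ifs <;> simp

end Determinants

section Hirota

variable {r : ℕ}

theorem comp_eq_one (z : Vert r → ℂ) {i m : ℕ} (h : ¬(1 ≤ i ∧ i ≤ r ∧ 1 ≤ m)) :
    comp z i m = 1 := dif_neg h

/-- The coefficients `x_k = z_{k1}` for `0 ≤ k ≤ r + 1`, extended by `0` beyond `r + 1`. -/
def initialRow (z : Vert r → ℂ) (k : ℕ) : ℂ := if k ≤ r + 1 then comp z k 1 else 0

theorem initialRow_zero (z : Vert r → ℂ) : initialRow z 0 = 1 := by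
  simp [initialRow, comp]

theorem initialRow_last (z : Vert r → ℂ) : initialRow z (r + 1) = 1 := by
  simp [initialRow, comp]

theorem initialRow_of_lt (z : Vert r → ℂ) (k : ℕ) (hk : r + 1 < k) : initialRow z k = 0 := by
  simp [initialRow, hk]

/-- A solution without vanishing components is given by Toeplitz determinants in its initial row:
this is the Jacobi–Trudi formula for rectangular shapes. -/
theorem comp_eq_det_toeplitz {z : Vert r → ℂ} (hz : IsSolution z) (hne : ∀ v, z v ≠ 0) (m : ℕ) :
    ∀ i ≤ r + 1, comp z i m = (toeplitz (initialRow z) i m).det := by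
  have hne' : ∀ i m, comp z i m ≠ 0 := by
    intro i m
    unfold comp
    split_ifs
    exacts [hne _, one_ne_zero]
  induction m using Nat.twoStepInduction with
  | zero =>
    intro i _
    rw [comp_eq_one z (by omega), Matrix.det_fin_zero]
  | one =>
    intro i hi
    simp [toeplitz, initialRow, hi]
  | more m ih0 ih1 =>
    intro i hi
    rcases Nat.eq_zero_or_pos i with rfl | hi0
    · rw [comp_eq_one z (by omega), det_toeplitz_zero (initialRow_zero z)]
    rcases hi.lt_or_eq with hi1 | rfl
    · have h := hz i (m + 1) hi0 (by omega) (by omega)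
      have hu : (toeplitz (initialRow z) i m).det ≠ 0 := by
        rw [← ih0 i hi]; exact hne' i m
      have hd := det_toeplitz_mul_det_toeplitz (initialRow z) hi0 m hu.isUnit
      rw [Nat.add_sub_cancel, ih1 (i - 1) (by omega), ih1 (i + 1) (by omega), ih0 i hi,
        ih1 i hi] at h
      refine mul_left_cancel₀ hu ?_
      linear_combination h - hd
    · rw [comp_eq_one z (by omega),
        det_toeplitz_of_vanishing (initialRow_last z) (initialRow_of_lt z)]

/-- On all of `S(A_r, A_ℕ)` the components `z_{1m}` are the Toeplitz determinants in the initial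
row: this is a polynomial identity, hence passes to the Zariski closure. -/
theorem comp_one_eq_det_toeplitz {z : Vert r → ℂ} (hz : z ∈ S r) (hr : 1 ≤ r) (m : ℕ) :
    comp z 1 m = (toeplitz (initialRow z) 1 m).det := by
  rcases Nat.eq_zero_or_pos m with rfl | hm
  · rw [comp_eq_one z (by omega), Matrix.det_fin_zero]
  let X : ℕ → MvPolynomial (Vert r) ℂ := fun k =>
    if k ≤ r + 1 then
      if h : 1 ≤ k ∧ k ≤ r ∧ 1 ≤ 1 then MvPolynomial.X ⟨(k, 1), h⟩ else 1
    else 0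
  let P : MvPolynomial (Vert r) ℂ :=
    MvPolynomial.X ⟨(1, m), le_rfl, hr, hm⟩ - (toeplitz X 1 m).det
  have hP : ∀ w : Vert r → ℂ, MvPolynomial.aeval w P =
      comp w 1 m - (toeplitz (initialRow w) 1 m).det := by
    intro w
    have hX : (fun k => MvPolynomial.aeval w (X k)) = initialRow w := by
      funext k
      simp only [X, initialRow, comp]
      split_ifs <;> simp
    have h1 := map_det_toeplitz (MvPolynomial.aeval (R := ℂ) w).toRingHom X 1 m
    simp only [AlgHom.toRingHom_eq_coe, RingHom.coe_coe, hX] at h1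
    simp only [P, map_sub, MvPolynomial.aeval_X, h1, comp]
    rw [dif_pos ⟨le_rfl, hr, hm⟩]
  have h0 := hz P fun w hw => by
    rw [hP, comp_eq_det_toeplitz hw.1 hw.2 m 1 (by omega), sub_self]
  rw [hP] at h0
  exact sub_eq_zero.mp h0

end Hirota

/-! ### Complete homogeneous symmetric functions of the roots -/

section CompleteSymmetric

variable {R : Type*} [CommRing R]

/-- If the power series `∑ (-1)^k x_k t^k` has inverse `∑ h_m t^m`, then `h_m` is the determinant
of the Toeplitz matrix `(x_{1 - a + b})`: up to sign, the latter is a corner cofactor of the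
unitriangular Toeplitz matrix `(x_{b - a})`, hence a corner entry of the inverse matrix. -/
theorem det_toeplitz_one_eq {x h : ℕ → R} (h0 : x 0 = 1)
    (hxh : PowerSeries.mk (fun k => (-1) ^ k * x k) * PowerSeries.mk h = 1) (m : ℕ) :
    (toeplitz x 1 m).det = h m := by
  have hrec : ∀ n, ∑ k ∈ Finset.range (n + 1), (-1) ^ k * x k * h (n - k) =
      if n = 0 then 1 else 0 := by
    intro n
    have := congrArg (PowerSeries.coeff n) hxh
    rw [PowerSeries.coeff_mul, Finset.Nat.sum_antidiagonal_eq_sum_range_succ_mk,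
      PowerSeries.coeff_one] at this
    simpa using this
  let E := toeplitz x 0 (m + 1)
  let v : Fin (m + 1) → R := fun b => (-1) ^ (b : ℕ) * h (m - b)
  have hEv : E *ᵥ v = Pi.single (Fin.last m) ((-1) ^ m) := by
    funext a
    obtain ⟨a, ha⟩ := a
    obtain ⟨n, rfl⟩ : ∃ n, m = a + n := ⟨m - a, by omega⟩
    have h1 : (E *ᵥ v) ⟨a, ha⟩ = ∑ b ∈ Finset.range (a + (n + 1)),
        (if a ≤ b then x (b - a) else 0) * ((-1) ^ b * h (a + n - b)) := by
      rw [Finset.sum_range]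
      simp only [E, v, Matrix.mulVec, dotProduct, toeplitz, Matrix.of_apply, zero_add]
      rfl
    rw [h1, Finset.sum_range_add, Finset.sum_eq_zero, zero_add]
    · have h2 : ∀ k ∈ Finset.range (n + 1),
          (if a ≤ a + k then x (a + k - a) else 0) * ((-1) ^ (a + k) * h (a + n - (a + k))) =
            (-1) ^ a * ((-1) ^ k * x k * h (n - k)) := by
        intro k _
        rw [if_pos (by omega), Nat.add_sub_cancel_left, Nat.add_sub_add_left]
        ring
      rw [Finset.sum_congr rfl h2, ← Finset.mul_sum, hrec]
      rcases Nat.eq_zero_or_pos n with rfl | hn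
      · have : (⟨a, ha⟩ : Fin (a + 0 + 1)) = Fin.last (a + 0) := rfl
        rw [this]
        simp
      · rw [Pi.single_eq_of_ne (by rw [Ne, Fin.ext_iff]; simp; omega), if_neg (by omega),
          mul_zero]
    · intro b hb
      rw [if_neg (by simpa using hb), zero_mul]
  have hE : E.det = 1 := det_toeplitz_zero h0 _
  have h2 : v = E.adjugate *ᵥ Pi.single (Fin.last m) ((-1) ^ m) := by
    rw [← hEv, Matrix.mulVec_mulVec, Matrix.adjugate_mul, hE, one_smul, Matrix.one_mulVec]
  have h3 := congrFun h2 0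
  have h4 : E.submatrix (Fin.last m).succAbove (0 : Fin (m + 1)).succAbove = toeplitz x 1 m := by
    ext a b
    simp only [E, toeplitz, Matrix.submatrix_apply, Matrix.of_apply, Fin.succAbove_last,
      Fin.succAbove_zero, Fin.val_castSucc, Fin.val_succ, zero_add, Nat.add_comm 1]
  rw [Matrix.mulVec_single, Pi.smul_apply, Matrix.col_apply,
    Matrix.adjugate_fin_succ_eq_det_submatrix, h4] at h3
  simp only [v, Fin.val_zero, pow_zero, one_mul, Nat.sub_zero, Fin.val_last, Nat.add_zero,
    MulOpposite.smul_eq_mul_unop, MulOpposite.unop_op] at h3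
  rw [h3, mul_right_comm, ← pow_add, Even.neg_one_pow ⟨m, rfl⟩, one_mul]

/-- The complete homogeneous symmetric polynomial `h_m`, evaluated at `g`. -/
def hsum {n : ℕ} (g : Fin n → R) (m : ℕ) : R :=
  ∑ d ∈ Finset.finsuppAntidiag Finset.univ m, ∏ i, g i ^ d i

theorem prod_one_sub_mul_mk_hsum {n : ℕ} (g : Fin n → R) :
    (∏ i, (1 - PowerSeries.C (g i) * PowerSeries.X)) * PowerSeries.mk (hsum g) = 1 := by
  have h1 : PowerSeries.mk (hsum g) = ∏ i, PowerSeries.mk (fun k => g i ^ k) := by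
    ext m
    simp [PowerSeries.coeff_prod, hsum]
  rw [h1, ← Finset.prod_mul_distrib]
  refine Finset.prod_eq_one fun i _ => ?_
  ext k
  rw [sub_mul, one_mul, mul_assoc, map_sub, PowerSeries.coeff_C_mul]
  cases k with
  | zero => simp
  | succ k => simp [PowerSeries.coeff_succ_X_mul, PowerSeries.coeff_one, pow_succ']

open Polynomial in
theorem reverse_prod_X_sub_C {K ι : Type*} [Field K] (s : Finset ι) (g : ι → K) :
    (∏ i ∈ s, (X - C (g i))).reverse = ∏ i ∈ s, (1 - C (g i) * X) := by
  classical
  have h1 : ∀ a : K, (X - C a).reverse = 1 - C a * X := by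
    intro a
    rw [reverse, natDegree_X_sub_C, reflect_sub, reflect_C, pow_one]
    have := reflect_monomial (R := K) 1 1
    rw [pow_one, revAt_le le_rfl, Nat.sub_self, pow_zero] at this
    rw [this]
  induction s using Finset.induction_on with
  | empty =>
    rw [Finset.prod_empty, Finset.prod_empty, ← C_1, reverse_C]
  | insert a s ha ih =>
    rw [Finset.prod_insert ha, Finset.prod_insert ha, reverse_mul_of_domain, h1, ih]

end CompleteSymmetric

section RootsOfCharPoly

variable {r : ℕ}

open Polynomial

theorem coeff_charPoly (z : Vert r → ℂ) {k : ℕ} (hk : k ≤ r + 1) :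
    (charPoly z).coeff k = (-1) ^ k * comp z (r + 1 - k) 1 := by
  rw [charPoly, finsetSum_coeff]
  simp only [coeff_C_mul, coeff_X_pow]
  rw [Finset.sum_eq_single k]
  · simp
  · intro j _ hj
    rw [if_neg (Ne.symm hj), mul_zero]
  · intro h
    exact absurd (Finset.mem_range.mpr (by omega)) h

theorem natDegree_charPoly (z : Vert r → ℂ) : (charPoly z).natDegree = r + 1 := by
  apply le_antisymm
  · refine natDegree_sum_le_of_forall_le _ _ fun k hk => ?_
    refine (natDegree_C_mul_X_pow_le _ _).trans ?_
    have := Finset.mem_range.mp hk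
    omega
  · apply le_natDegree_of_ne_zero
    rw [coeff_charPoly z le_rfl, Nat.sub_self, comp_eq_one z (by omega)]
    simp

theorem charPoly_eq_prod (z : Vert r → ℂ) {g : Fin (r + 1) → ℂ}
    (hg : (charPoly z).roots = Multiset.map g Finset.univ.val) :
    charPoly z = C ((-1) ^ (r + 1)) * ∏ i, (X - C (g i)) := by
  have h1 := (IsAlgClosed.splits (charPoly z)).eq_prod_roots
  rw [leadingCoeff, natDegree_charPoly, coeff_charPoly z le_rfl, Nat.sub_self,
    comp_eq_one z (by omega), mul_one, hg, Multiset.map_map] at h1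
  exact h1

theorem prod_roots_charPoly (z : Vert r → ℂ) {g : Fin (r + 1) → ℂ}
    (hg : (charPoly z).roots = Multiset.map g Finset.univ.val) : ∏ i, g i = 1 := by
  have h1 := congrArg (Polynomial.eval 0) (charPoly_eq_prod z hg)
  rw [← coeff_zero_eq_eval_zero, coeff_charPoly z (by omega), comp_eq_one z (by omega)] at h1
  simp only [eval_mul, eval_prod, eval_sub, eval_X, eval_C, zero_sub, Finset.prod_neg] at h1
  simp only [Finset.card_univ, Fintype.card_fin, ← mul_assoc, ← pow_add] at h1
  rw [Even.neg_one_pow ⟨r + 1, rfl⟩] at h1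
  simpa using h1.symm

theorem prod_one_sub_roots (z : Vert r → ℂ) {g : Fin (r + 1) → ℂ}
    (hg : (charPoly z).roots = Multiset.map g Finset.univ.val) :
    ∏ i, (1 - PowerSeries.C (g i) * PowerSeries.X) =
      PowerSeries.mk fun k => (-1) ^ k * initialRow z k := by
  have h1 := congrArg Polynomial.reverse (charPoly_eq_prod z hg)
  rw [reverse_mul_of_domain, reverse_C, reverse_prod_X_sub_C] at h1
  have h2 : (∏ i, (1 - PowerSeries.C (g i) * PowerSeries.X) : PowerSeries ℂ) =
      ((∏ i, (1 - C (g i) * X) : ℂ[X]) : PowerSeries ℂ) := by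
    rw [← Polynomial.coeToPowerSeries.ringHom_apply, map_prod]
    simp
  rw [h2]
  ext k
  rw [Polynomial.coeff_coe, PowerSeries.coeff_mk]
  have h3 := congrArg (fun p => (-1) ^ (r + 1) * p.coeff k) h1
  simp only [coeff_C_mul, coeff_reverse, natDegree_charPoly] at h3
  rw [← mul_assoc, ← pow_add, Even.neg_one_pow ⟨r + 1, rfl⟩, one_mul] at h3
  rw [← h3]
  by_cases hk : k ≤ r + 1
  · rw [revAt_le hk, coeff_charPoly z (by omega), initialRow, if_pos hk, ← mul_assoc, ← pow_add,
      show r + 1 - (r + 1 - k) = k by omega]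
    congr 1
    rw [show r + 1 + (r + 1 - k) = 2 * (r + 1 - k) + k by omega, pow_add, pow_mul]
    simp
  · rw [initialRow_of_lt z k (by omega), revAt_eq_self_of_lt (by omega),
      coeff_eq_zero_of_natDegree_lt (by rw [natDegree_charPoly]; omega), mul_zero, mul_zero]

/-- On `S(A_r, A_ℕ)` the component `z_{1m}` is `h_m` of the roots of the polynomial `p`. -/
theorem comp_one_eq_hsum {z : Vert r → ℂ} (hz : z ∈ S r) (hr : 1 ≤ r) {g : Fin (r + 1) → ℂ}
    (hg : (charPoly z).roots = Multiset.map g Finset.univ.val) (m : ℕ) :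
    comp z 1 m = hsum g m := by
  rw [comp_one_eq_det_toeplitz hz hr]
  refine det_toeplitz_one_eq (initialRow_zero z) ?_ m
  rw [← prod_one_sub_roots z hg, prod_one_sub_mul_mk_hsum]

end RootsOfCharPoly

/-! ### Highest weight vectors and matrix coefficients -/

section BigCell

/-- The element of `SL(r+1, ℂ)` with matrix `A`; the junk value `1` is used if `det A ≠ 1`. -/
def toSL {r : ℕ} (A : Matrix (Fin (r + 1)) (Fin (r + 1)) ℂ) : SLr r :=
  if h : A.det = 1 then ⟨A, h⟩ else 1

variable {r : ℕ}

theorem toSL_of_det {A : Matrix (Fin (r + 1)) (Fin (r + 1)) ℂ} (h : A.det = 1) :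
    toSL A = ⟨A, h⟩ := dif_pos h

theorem toSL_val {A : Matrix (Fin (r + 1)) (Fin (r + 1)) ℂ} (h : A.det = 1) : (toSL A).1 = A := by
  rw [toSL_of_det h]

theorem toSL_coe (g : SLr r) : toSL g.1 = g := toSL_of_det g.2

theorem toSL_mul {A B : Matrix (Fin (r + 1)) (Fin (r + 1)) ℂ} (hA : A.det = 1) (hB : B.det = 1) :
    toSL (A * B) = toSL A * toSL B := by
  rw [toSL_of_det hA, toSL_of_det hB, toSL_of_det (by rw [Matrix.det_mul, hA, hB, one_mul])]
  rfl

/-- A matrix whose leading principal minors do not vanish becomes lower triangular after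
multiplication from the right with an upper unitriangular matrix. -/
theorem exists_mul_lowerTriangular {K : Type*} [Field K] {n : ℕ} (g : Matrix (Fin n) (Fin n) K)
    (hg : ∀ j : Fin n, (g.submatrix (Fin.castLE j.2.le) (Fin.castLE j.2.le)).det ≠ 0) :
    ∃ R : Matrix (Fin n) (Fin n) K, (∀ i, R i i = 1) ∧ (∀ i j, j < i → R i j = 0) ∧
      ∀ i j, i < j → (g * R) i j = 0 := by
  -- column `j` of `R` solves the linear system given by the leading block of size `j`
  let B : ∀ j : Fin n, Matrix (Fin j) (Fin j) K := fun j =>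
    g.submatrix (Fin.castLE j.2.le) (Fin.castLE j.2.le)
  let x : ∀ j : Fin n, Fin j → K := fun j => (B j)⁻¹ *ᵥ fun k => -g (Fin.castLE j.2.le k) j
  let N : Matrix (Fin n) (Fin n) K := Matrix.of fun i j => if h : i < j then x j ⟨i, h⟩ else 0
  have hN : ∀ i j, j ≤ i → N i j = 0 := fun i j h => by
    simp only [N, Matrix.of_apply]
    rw [dif_neg (not_lt.mpr h)]
  refine ⟨1 + N, fun i => by simp [hN i i le_rfl], fun i j h => ?_, fun i j h => ?_⟩
  · rw [Matrix.add_apply, hN i j h.le, Matrix.one_apply_ne h.ne', add_zero]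
  · have h1 : B j *ᵥ x j = fun k => -g (Fin.castLE j.2.le k) j := by
      rw [Matrix.mulVec_mulVec, Matrix.mul_nonsing_inv _ (hg j).isUnit, Matrix.one_mulVec]
    have h2 := congrFun h1 ⟨i, h⟩
    have h3 : (g * N) i j = -g i j := by
      rw [show -g i j = -g (Fin.castLE j.2.le ⟨i, h⟩) j from rfl, ← h2, Matrix.mul_apply]
      symm
      refine Fintype.sum_of_injective (Fin.castLE j.2.le) (Fin.castLE_injective _) _ _ ?_ ?_
      · intro k hk
        rw [hN k j, mul_zero]
        by_contra hlt
        exact hk ⟨⟨k, not_le.mp hlt⟩, rfl⟩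
      · intro k
        have hk : Fin.castLE j.2.le k < j := k.2
        simp only [N, Matrix.of_apply]
        rw [dif_pos hk]
        rfl
    rw [Matrix.mul_add, Matrix.mul_one, Matrix.add_apply, h3, add_neg_cancel]

end BigCell

section HighestWeight

variable {r : ℕ} {V : Type*} [AddCommGroup V] [Module ℂ V]

theorem fundWeight_one (t : Fin (r + 1) → ℂ) : fundWeight r 1 t = t 0 := by
  rw [fundWeight, Finset.prod_eq_single 0]
  · simp
  · intro j _ hj
    rw [if_neg]
    have : (j : ℕ) ≠ 0 := fun h => hj (Fin.ext h)
    omega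
  · simp

theorem differentiable_eval_mvPolynomial {ι : Type*} (P : MvPolynomial ι ℂ) {f : ι → ℂ → ℂ}
    (hf : ∀ i, Differentiable ℂ (f i)) :
    Differentiable ℂ fun s => MvPolynomial.eval (fun i => f i s) P := by
  induction P using MvPolynomial.induction_on with
  | C a => simp
  | add p q hp hq => simp only [map_add]; exact hp.add hq
  | mul_X p i hp => simp only [map_mul, MvPolynomial.eval_X]; exact hp.mul (hf i)

/-- The one-parameter torus `diag(s^{-r}, s^{2-r}, …, s^r)` lies in `SL(r+1, ℂ)`. -/
theorem det_diagonal_zpow {s : ℂ} (hs : s ≠ 0) :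
    (Matrix.diagonal fun i : Fin (r + 1) => s ^ (2 * (i : ℤ) - r)).det = 1 := by
  rw [Matrix.det_diagonal]
  have h1 : ∀ i : Fin (r + 1), s ^ (2 * (i : ℤ) - r) =
      s ^ (i : ℕ) / s ^ ((Fin.rev i : Fin _) : ℕ) := by
    intro i
    rw [← zpow_natCast, ← zpow_natCast, ← zpow_sub₀ hs, Fin.val_rev]
    congr 1
    omega
  simp only [h1, Finset.prod_div_distrib]
  rw [Fintype.prod_equiv Fin.revPerm (fun i => s ^ ((Fin.rev i : Fin _) : ℕ))
    (fun i : Fin (r + 1) => s ^ (i : ℕ)) (fun i => rfl)]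
  exact div_self (Finset.prod_ne_zero_iff.mpr fun i _ => pow_ne_zero _ hs)

variable {ρ : Representation ℂ (SLr r) V}

/-- A highest weight vector `v` of an algebraic representation admits a linear functional which
equals `1` on all translates of `v` by lower unitriangular matrices. It is the projection to the
weight space of `v` for a one-parameter torus `γ(s)`, followed by any functional with value `1`
at `v`; the projection is the average over `|s| = 1`, and as `s → 0` contracts the lower
unitriangular group to the identity, its value is found from the mean value property. -/
theorem exists_functional (hρ : IsAlgebraicRep ρ) {m : ℕ} {v : V} (hv : v ≠ 0)
    (hT : ∀ (t : Fin (r + 1) → ℂ) (ht : (Matrix.diagonal t).det = 1),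
      ρ (⟨Matrix.diagonal t, ht⟩ : SLr r) v = fundWeight r 1 t ^ m • v) :
    ∃ l : Module.Dual ℂ V, ∀ y : SLr r, (∀ i, y.1 i i = 1) → (∀ i j, i < j → y.1 i j = 0) →
      l (ρ y v) = 1 := by
  obtain ⟨l₀, hl₀⟩ : ∃ l₀ : Module.Dual ℂ V, l₀ v = 1 := by
    obtain ⟨φ, hφ⟩ : ∃ φ : Module.Dual ℂ V, φ v ≠ 0 := by
      by_contra! h
      exact hv ((Module.forall_dual_apply_eq_zero_iff ℂ v).mp h)
    exact ⟨(φ v)⁻¹ • φ, by simp [hφ]⟩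
  let D : ℂ → Matrix (Fin (r + 1)) (Fin (r + 1)) ℂ := fun s =>
    Matrix.diagonal fun i => s ^ (2 * (i : ℤ) - r)
  have hD : ∀ s ≠ 0, (D s).det = 1 := fun s hs => det_diagonal_zpow hs
  have hDv : ∀ s ≠ 0, (s ^ r) ^ m • ρ (toSL (D s)) v = v := by
    intro s hs
    rw [toSL_of_det (hD s hs), hT, fundWeight_one, smul_smul, ← mul_pow, ← zpow_natCast s r,
      ← zpow_add₀ hs]
    simp
  have hne : ∀ s ∈ Metric.sphere (0 : ℂ) |1|, s ≠ 0 := by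
    rintro s hs rfl
    simp at hs
  -- on the sphere the factor `s ^ (r m)` is inverse to the weight of `v`
  let F : V → ℂ → ℂ := fun w s => (s ^ r) ^ m * l₀ (ρ (toSL (D s)) w)
  have hF : ∀ w, CircleIntegrable (F w) 0 1 := by
    intro w
    obtain ⟨P, hP⟩ := hρ l₀ w
    refine ContinuousOn.circleIntegrable zero_le_one ?_
    rw [← abs_one (α := ℝ)]
    have : Set.EqOn (F w) (fun s => (s ^ r) ^ m *
        MvPolynomial.eval (fun ij => D s ij.1 ij.2) P) (Metric.sphere (0 : ℂ) |1|) := by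
      intro s hs
      simp only [F]
      rw [hP, toSL_of_det (hD s (hne s hs))]
    refine ContinuousOn.congr ?_ this
    refine ContinuousOn.mul (by fun_prop) ?_
    refine (MvPolynomial.continuous_eval P).comp_continuousOn ?_
    refine continuousOn_pi.mpr fun ij => ?_
    simp only [D, Matrix.diagonal_apply]
    split_ifs
    · exact fun s hs => (continuousAt_zpow₀ s _ (Or.inl (hne s hs))).continuousWithinAt
    · exact continuousOn_const
  let l : Module.Dual ℂ V :=
    { toFun := fun w => Real.circleAverage (F w) 0 1
      map_add' := fun w₁ w₂ => by
        rw [← Real.circleAverage_add (hF w₁) (hF w₂)]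
        congr 1
        funext s
        simp [F, mul_add]
      map_smul' := fun c w => by
        rw [RingHom.id_apply, ← Real.circleAverage_smul]
        congr 1
        funext s
        simp [F, mul_left_comm] }
  refine ⟨l, fun y hy1 hy0 => ?_⟩
  obtain ⟨P, hP⟩ := hρ l₀ v
  -- `Y s` is the conjugate of `y` by `D s`, extended to `s = 0`
  let Y : ℂ → Matrix (Fin (r + 1)) (Fin (r + 1)) ℂ := fun s =>
    Matrix.of fun i j => y.1 i j * s ^ (2 * ((i : ℕ) - j))
  have hY : ∀ s, (Y s).det = 1 := by
    intro s
    rw [Matrix.det_of_isLowerTriangular]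
    · simp [Y, hy1]
    · intro i j hij
      simp [Y, hy0 i j hij]
  have hYD : ∀ s ≠ 0, D s * y.1 = Y s * D s := by
    intro s hs
    ext i j
    simp only [D, Matrix.diagonal_mul, Matrix.mul_diagonal, Y, Matrix.of_apply]
    rcases lt_or_ge i j with hij | hij
    · rw [hy0 i j hij]; simp
    · rw [mul_assoc, ← zpow_natCast, ← zpow_add₀ hs, mul_comm]
      congr 2
      have : (j : ℕ) ≤ i := hij
      push_cast [this]
      ring
  have h1 : Real.circleAverage (F (ρ y v)) 0 1 = Real.circleAverage
      (fun s => MvPolynomial.eval (fun ij => Y s ij.1 ij.2) P) 0 1 := by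
    refine Real.circleAverage_congr_sphere fun s hs => ?_
    have hs0 := hne s hs
    simp only [F]
    rw [← Module.End.mul_apply, ← map_mul, ← toSL_coe y, ← toSL_mul (hD s hs0) y.2, hYD s hs0,
      toSL_mul (hY s) (hD s hs0), map_mul, Module.End.mul_apply, ← smul_eq_mul, ← map_smul,
      ← map_smul, hDv s hs0, hP, toSL_of_det (hY s)]
  have hdiff : Differentiable ℂ (fun s => MvPolynomial.eval (fun ij => Y s ij.1 ij.2) P) := by
    refine differentiable_eval_mvPolynomial (f := fun ij s => Y s ij.1 ij.2) P fun ij => ?_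
    simp only [Y, Matrix.of_apply]
    fun_prop
  have hY0 : Y 0 = 1 := by
    ext i j
    simp only [Y, Matrix.of_apply]
    rcases lt_trichotomy i j with hij | rfl | hij
    · rw [hy0 i j hij, Matrix.one_apply_ne hij.ne, zero_mul]
    · simp [hy1]
    · have : (j : ℕ) < i := hij
      rw [Matrix.one_apply_ne hij.ne', zero_pow (by omega), mul_zero]
  change Real.circleAverage (F (ρ y v)) 0 1 = 1
  rw [h1, DiffContOnCl.circleAverage hdiff.diffContOnCl, hY0]
  have := hP 1
  rw [map_one, Module.End.one_apply, hl₀] at this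
  exact this.symm

/-- A highest weight vector `v` of weight `m λ_1` has the matrix coefficient `g ↦ g_{11}^m`. -/
theorem exists_functional_matrixCoeff (hρ : IsAlgebraicRep ρ) {m : ℕ}
    {v : V} (hv : v ≠ 0)
    (hU : ∀ u : SLr r, (∀ i, u.1 i i = 1) → (∀ i j, j < i → u.1 i j = 0) → ρ u v = v)
    (hT : ∀ (t : Fin (r + 1) → ℂ) (ht : (Matrix.diagonal t).det = 1),
      ρ (⟨Matrix.diagonal t, ht⟩ : SLr r) v = fundWeight r 1 t ^ m • v) :
    ∃ l : Module.Dual ℂ V, ∀ g : SLr r, l (ρ g v) = g.1 0 0 ^ m := by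
  obtain ⟨l, hl⟩ := exists_functional hρ hv hT
  refine ⟨l, ?_⟩
  have hlow : ∀ L : SLr r, (∀ i j, i < j → L.1 i j = 0) → l (ρ L v) = L.1 0 0 ^ m := by
    intro L hL
    have hdet : ∏ i, L.1 i i = 1 := by
      rw [← Matrix.det_of_isLowerTriangular _ (fun i j hij => hL i j hij), L.2]
    have hne : ∀ i, L.1 i i ≠ 0 := fun i h => by
      rw [Finset.prod_eq_zero (f := fun i => L.1 i i) (Finset.mem_univ i) h] at hdet
      exact zero_ne_one hdet
    have hD : (Matrix.diagonal fun i => L.1 i i).det = 1 := by rw [Matrix.det_diagonal, hdet]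
    let y : Matrix (Fin (r + 1)) (Fin (r + 1)) ℂ := Matrix.of fun i j => L.1 i j / L.1 j j
    have hy1 : ∀ i, y i i = 1 := fun i => div_self (hne i)
    have hy0 : ∀ i j, i < j → y i j = 0 := fun i j hij => by simp [y, hL i j hij]
    have hy : y.det = 1 := by
      rw [Matrix.det_of_isLowerTriangular y (fun i j hij => hy0 i j hij)]
      simp [hy1]
    have hLy : L = toSL y * toSL (Matrix.diagonal fun i => L.1 i i) := by
      rw [← toSL_mul hy hD, ← toSL_coe L]
      congr 1
      ext i j
      rw [Matrix.mul_diagonal, toSL_coe]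
      simp [y, hne j]
    conv_lhs => rw [hLy]
    rw [map_mul, Module.End.mul_apply, toSL_of_det hD, hT, map_smul, map_smul,
      hl (toSL y) (by rw [toSL_val hy]; exact hy1) (by rw [toSL_val hy]; exact hy0),
      fundWeight_one, smul_eq_mul, mul_one]
  have hcell : ∀ g : SLr r,
      (∀ j : Fin (r + 1), (g.1.submatrix (Fin.castLE j.2.le) (Fin.castLE j.2.le)).det ≠ 0) →
      l (ρ g v) = g.1 0 0 ^ m := by
    intro g hg
    obtain ⟨R, hR1, hR0, hgR⟩ := exists_mul_lowerTriangular g.1 hg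
    have hR : R.det = 1 := by
      rw [Matrix.det_of_isUpperTriangular (fun i j hij => hR0 i j hij)]
      simp [hR1]
    have hval : (g * toSL R).1 = g.1 * R := by
      change g.1 * (toSL R).1 = g.1 * R
      rw [toSL_val hR]
    have h1 := hlow (g * toSL R) (by rw [hval]; exact hgR)
    have h2 : (g.1 * R) 0 0 = g.1 0 0 := by
      rw [Matrix.mul_apply, Finset.sum_eq_single 0]
      · rw [hR1, mul_one]
      · intro k _ hk
        rw [hR0 k 0 (Fin.pos_of_ne_zero hk), mul_zero]
      · simp
    rwa [hval, h2, map_mul, Module.End.mul_apply, hU (toSL R) (by rw [toSL_val hR]; exact hR1)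
      (by rw [toSL_val hR]; exact hR0)] at h1
  intro g
  -- a curve in `SL(r+1, ℂ)` which passes through `g` at `s = 1` and lies in the big cell for
  -- all but finitely many `s`
  let AX : Matrix (Fin (r + 1)) (Fin (r + 1)) (Polynomial ℂ) :=
    Matrix.of fun i j => Polynomial.C ((1 : Matrix _ _ ℂ) i j) +
      Polynomial.X * Polynomial.C (g.1 i j - (1 : Matrix _ _ ℂ) i j)
  let A : ℂ → Matrix (Fin (r + 1)) (Fin (r + 1)) ℂ := fun s =>
    Matrix.of fun i j => (AX i j).eval s
  have hA0 : A 0 = 1 := by ext i j; simp [A, AX]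
  have hA1 : A 1 = g.1 := by ext i j; simp [A, AX]
  have hdet : ∀ s, (AX.det).eval s = (A s).det := fun s =>
    RingHom.map_det (Polynomial.evalRingHom s) AX
  let q : Fin (r + 1) → Polynomial ℂ := fun j =>
    (AX.submatrix (Fin.castLE j.2.le) (Fin.castLE j.2.le)).det
  have hq : ∀ j s, (q j).eval s =
      ((A s).submatrix (Fin.castLE j.2.le) (Fin.castLE j.2.le)).det := fun j s =>
    RingHom.map_det (Polynomial.evalRingHom s) _
  let Q := AX.det * ∏ j, q j
  have hQ : Q ≠ 0 := by
    intro h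
    have h1 := congrArg (Polynomial.eval 0) h
    simp only [Q, Polynomial.eval_mul, Polynomial.eval_prod, hdet, hq, hA0] at h1
    simp only [Matrix.submatrix_one _ (Fin.castLE_injective _), Matrix.det_one] at h1
    simp at h1
  let G : ℂ → Matrix (Fin (r + 1)) (Fin (r + 1)) ℂ := fun s =>
    Matrix.of fun i j => (A s) i j * if j = Fin.last r then ((A s).det)⁻¹ else 1
  have hG1 : G 1 = g.1 := by
    ext i j
    simp only [G, Matrix.of_apply, hA1]
    rw [show g.1.det = 1 from g.2]
    simp
  have hGdet : ∀ s, (A s).det ≠ 0 → (G s).det = 1 := by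
    intro s hs
    have : G s = A s * Matrix.diagonal
        (fun j => if j = Fin.last r then ((A s).det)⁻¹ else 1) := by
      ext i j
      rw [Matrix.mul_diagonal]
      rfl
    rw [this, Matrix.det_mul, Matrix.det_diagonal, Finset.prod_ite_eq' Finset.univ (Fin.last r)]
    simp [hs]
  have hGminor : ∀ s (j : Fin (r + 1)),
      (G s).submatrix (Fin.castLE j.2.le) (Fin.castLE j.2.le) =
        (A s).submatrix (Fin.castLE j.2.le) (Fin.castLE j.2.le) := by
    intro s j
    ext a b
    have hb : (Fin.castLE j.2.le b : Fin (r + 1)) ≠ Fin.last r := by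
      intro h
      have h1 := congrArg Fin.val h
      have h2 := b.2
      have h3 := j.2
      simp at h1
      omega
    simp [G, hb]
  obtain ⟨P, hP⟩ := hρ l v
  let f : ℂ → ℂ := fun s => MvPolynomial.eval (fun ij => G s ij.1 ij.2) P - G s 0 0 ^ m
  have hGc : ∀ i j, ContinuousAt (fun s => G s i j) 1 := by
    intro i j
    simp only [G, Matrix.of_apply]
    have hAc : ContinuousAt (fun s => A s i j) 1 := (Polynomial.continuous _).continuousAt
    refine hAc.mul ?_
    split_ifs
    · refine ContinuousAt.inv₀ ?_ ?_
      · simp only [← hdet]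
        exact (Polynomial.continuous _).continuousAt
      · rw [hA1, show g.1.det = 1 from g.2]
        exact one_ne_zero
    · exact continuousAt_const
  have hf : ContinuousAt f 1 := by
    refine ContinuousAt.sub ?_ ((hGc 0 0).pow m)
    refine ContinuousAt.comp (f := fun s (ij : Fin (r + 1) × Fin (r + 1)) => G s ij.1 ij.2)
      (MvPolynomial.continuous_eval P).continuousAt ?_
    exact continuousAt_pi.mpr fun ij => hGc _ _
  have hf0 : ∀ᶠ s in nhdsWithin 1 {(1 : ℂ)}ᶜ, f s = 0 := by
    have hfin : {s | Q.IsRoot s}.Finite := Polynomial.finite_setOfPred_isRoot hQ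
    have h1 : ∀ᶠ s in nhdsWithin 1 {(1 : ℂ)}ᶜ, ¬ Q.IsRoot s := by
      have h2 := (hfin.subset (Set.sdiff_subset (t := {1}))).isClosed.isOpen_compl.mem_nhds
        (x := (1 : ℂ)) (by simp)
      filter_upwards [nhdsWithin_le_nhds h2, self_mem_nhdsWithin] with s hs hs1 hroot
      exact hs ⟨hroot, hs1⟩
    filter_upwards [h1] with s hs
    simp only [Polynomial.IsRoot.def, Q, Polynomial.eval_mul, Polynomial.eval_prod, hdet, hq,
      mul_eq_zero, Finset.prod_eq_zero_iff, not_or, not_exists, not_and] at hs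
    have hG := toSL_val (hGdet s hs.1)
    have h2 := hcell (toSL (G s)) fun j => by
      rw [hG, hGminor]
      exact hs.2 j (Finset.mem_univ j)
    rw [hP, hG] at h2
    exact sub_eq_zero.mpr h2
  have h0 : f 1 = 0 := tendsto_nhds_unique (hf.tendsto.mono_left nhdsWithin_le_nhds)
    (Filter.Tendsto.congr' (hf0.mono fun _ h => h.symm) tendsto_const_nhds)
  rw [hP, ← sub_eq_zero, ← h0]
  simp only [f, hG1]

end HighestWeight

section MatrixCoefficient

variable {G : Type*} [Group G] {V W : Type*} [AddCommGroup V] [Module ℂ V]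
  [AddCommGroup W] [Module ℂ W]

theorem eq_top_of_invariant {ρ : Representation ℂ G V} (hρ : ρ.IsIrreducible) (U : Submodule ℂ V)
    (hU : ∀ g, ∀ u ∈ U, ρ g u ∈ U) {u : V} (hu : u ∈ U) (hu0 : u ≠ 0) : U = ⊤ := by
  rcases hρ.eq_bot_or_eq_top ⟨U, fun g u h => hU g u h⟩ with h | h
  · have h1 : U = ⊥ := congrArg Subrepresentation.toSubmodule h
    rw [h1, Submodule.mem_bot] at hu
    exact absurd hu hu0
  · exact congrArg Subrepresentation.toSubmodule h

/-- The map sending `w` to the matrix coefficient `g ↦ l (ρ g w)`. -/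
def matrixCoeff (ρ : Representation ℂ G V) (l : Module.Dual ℂ V) : V →ₗ[ℂ] G → ℂ :=
  LinearMap.pi fun g => l ∘ₗ ρ g

theorem matrixCoeff_apply (ρ : Representation ℂ G V) (l : Module.Dual ℂ V) (w : V) (g : G) :
    matrixCoeff ρ l w g = l (ρ g w) := rfl

theorem matrixCoeff_injective {ρ : Representation ℂ G V} (hρ : ρ.IsIrreducible)
    {l : Module.Dual ℂ V} {v : V} (h : l v ≠ 0) : Function.Injective (matrixCoeff ρ l) := by
  rw [injective_iff_map_eq_zero]
  intro u hu
  by_contra hu0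
  have htop := eq_top_of_invariant hρ (LinearMap.ker (matrixCoeff ρ l)) (fun g w hw => by
    rw [LinearMap.mem_ker] at hw ⊢
    funext k
    rw [matrixCoeff_apply, ← Module.End.mul_apply, ← map_mul, ← matrixCoeff_apply, hw]
    rfl) (u := u) hu hu0
  have hv : v ∈ LinearMap.ker (matrixCoeff ρ l) := htop ▸ Submodule.mem_top
  have := congrFun (LinearMap.mem_ker.mp hv) 1
  rw [matrixCoeff_apply, map_one] at this
  exact h this

/-- The translates of a nonzero vector of an irreducible representation span it, so the image of
`matrixCoeff` is spanned by the translates of the matrix coefficient of that vector. -/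
theorem range_matrixCoeff {ρ : Representation ℂ G V} (hρ : ρ.IsIrreducible)
    (l : Module.Dual ℂ V) {v : V} (hv : v ≠ 0) :
    LinearMap.range (matrixCoeff ρ l) =
      Submodule.span ℂ (Set.range fun h : G => fun g : G => l (ρ (g * h) v)) := by
  have htop : Submodule.span ℂ (Set.range fun h : G => ρ h v) = ⊤ := by
    refine eq_top_of_invariant hρ _ (fun g u hu => ?_)
      (Submodule.subset_span ⟨1, rfl⟩) (by simpa using hv)
    have : Submodule.span ℂ (Set.range fun h : G => ρ h v) ≤
        (Submodule.span ℂ (Set.range fun h : G => ρ h v)).comap (ρ g) := by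
      rw [Submodule.span_le]
      rintro _ ⟨h, rfl⟩
      exact Submodule.subset_span ⟨g * h, by simp⟩
    exact this hu
  rw [LinearMap.range_eq_map, ← htop, Submodule.map_span, ← Set.range_comp]
  congr 2
  funext h g
  simp [matrixCoeff_apply]

/-- Two irreducible representations which share a nonzero matrix coefficient have the same
character: both embed equivariantly into the functions on the group, with the same image, the span
of the translates of that matrix coefficient. -/
theorem character_eq_of_matrixCoeff_eq {ρ : Representation ℂ G V} {σ : Representation ℂ G W}
    (hρ : ρ.IsIrreducible) (hσ : σ.IsIrreducible) {l : Module.Dual ℂ V} {k : Module.Dual ℂ W}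
    {v : V} {w : W} (h : ∀ g, l (ρ g v) = k (σ g w)) (hlv : l v ≠ 0) (g : G) :
    ρ.character g = σ.character g := by
  have hkw : k w ≠ 0 := by
    have := h 1
    simp only [map_one, Module.End.one_apply] at this
    rwa [← this]
  have hv : v ≠ 0 := fun h => hlv (by rw [h, map_zero])
  have hw : w ≠ 0 := fun h => hkw (by rw [h, map_zero])
  have hrange : LinearMap.range (matrixCoeff ρ l) = LinearMap.range (matrixCoeff σ k) := by
    rw [range_matrixCoeff hρ l hv, range_matrixCoeff hσ k hw]
    simp only [h]
  let e₁ := LinearEquiv.ofInjective _ (matrixCoeff_injective hρ hlv)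
  let e₂ := LinearEquiv.ofInjective _ (matrixCoeff_injective hσ hkw)
  let e : V ≃ₗ[ℂ] W := e₁.trans ((LinearEquiv.ofEq _ _ hrange).trans e₂.symm)
  have he : ∀ x, matrixCoeff σ k (e x) = matrixCoeff ρ l x := by
    intro x
    have : e₂ (e x) = LinearEquiv.ofEq _ _ hrange (e₁ x) := by simp [e]
    exact congrArg Subtype.val this
  have hconj : e.conj (ρ g) = σ g := by
    ext y
    obtain ⟨x, rfl⟩ := e.surjective y
    rw [LinearEquiv.conj_apply_apply, LinearEquiv.symm_apply_apply]
    apply matrixCoeff_injective hσ hkw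
    funext a
    have h1 := congrFun (he x) (a * g)
    rw [he, matrixCoeff_apply, matrixCoeff_apply]
    rw [matrixCoeff_apply, matrixCoeff_apply, map_mul, map_mul] at h1
    exact h1.symm
  rw [Representation.character, Representation.character, ← hconj, LinearMap.trace_conj']

end MatrixCoefficient

/-! ### Symmetric powers of the standard representation -/

section Substitution

open MvPolynomial

variable {n : ℕ}

/-- The linear substitution `X_j ↦ ∑_i A_{ij} X_i`: the action of `A` on the symmetric algebra of
the space of column vectors, `X_j` being the `j`-th standard basis vector. -/
def linSubst (A : Matrix (Fin n) (Fin n) ℂ) : MvPolynomial (Fin n) ℂ →ₐ[ℂ] MvPolynomial (Fin n) ℂ :=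
  aeval fun j => ∑ i, A i j • X i

theorem linSubst_X (A : Matrix (Fin n) (Fin n) ℂ) (j : Fin n) :
    linSubst A (X j) = ∑ i, A i j • X i := aeval_X _ _

theorem linSubst_one : linSubst (1 : Matrix (Fin n) (Fin n) ℂ) = AlgHom.id ℂ _ := by
  refine MvPolynomial.algHom_ext fun j => ?_
  simp [linSubst_X, Matrix.one_apply, ite_smul]

theorem linSubst_mul (A B : Matrix (Fin n) (Fin n) ℂ) :
    linSubst (A * B) = (linSubst A).comp (linSubst B) := by
  refine MvPolynomial.algHom_ext fun j => ?_
  simp only [AlgHom.comp_apply, linSubst_X, map_sum, map_smul, Matrix.mul_apply, Finset.sum_smul,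
    Finset.smul_sum, smul_smul]
  rw [Finset.sum_comm]
  simp only [mul_comm]

theorem isHomogeneous_linSubst (A : Matrix (Fin n) (Fin n) ℂ) {m : ℕ} {f : MvPolynomial (Fin n) ℂ}
    (hf : f.IsHomogeneous m) : (linSubst A f).IsHomogeneous m := by
  have := hf.aeval (S := ℂ) (n := 1) (fun j => ∑ i, A i j • (X i : MvPolynomial (Fin n) ℂ))
    fun j => IsHomogeneous.sum _ _ _ fun i _ => by
      rw [smul_eq_C_mul]
      exact isHomogeneous_C_mul_X _ _
  rwa [one_mul] at this

theorem coeff_linSubst_diagonal (t : Fin n → ℂ) (f : MvPolynomial (Fin n) ℂ) (d : Fin n →₀ ℕ) :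
    coeff d (linSubst (Matrix.diagonal t) f) = (∏ i, t i ^ d i) * coeff d f := by
  have hX : ∀ j, linSubst (Matrix.diagonal t) (X j) = C (t j) * X j := by
    intro j
    simp [linSubst_X, Matrix.diagonal_apply, ite_smul, smul_eq_C_mul]
  have hmon : ∀ e : Fin n →₀ ℕ, ∀ a : ℂ, linSubst (Matrix.diagonal t) (monomial e a) =
      monomial e ((∏ i, t i ^ e i) * a) := by
    intro e a
    rw [monomial_eq, monomial_eq, map_mul, Finsupp.prod_fintype _ _ (by simp), map_prod]
    simp only [map_pow, hX, mul_pow, Finset.prod_mul_distrib, algHom_C, map_mul, map_prod]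
    rw [algebraMap_eq]
    ring
  induction f using MvPolynomial.induction_on' with
  | monomial e a =>
    rw [hmon, coeff_monomial, coeff_monomial]
    split_ifs with h
    · rw [h]
    · rw [mul_zero]
  | add p q hp hq => rw [map_add, coeff_add, coeff_add, hp, hq, mul_add]

theorem linSubst_smul (c : ℂ) (A : Matrix (Fin n) (Fin n) ℂ) {m : ℕ} {f : MvPolynomial (Fin n) ℂ}
    (hf : f.IsHomogeneous m) : linSubst (c • A) f = c ^ m • linSubst A f := by
  have h1 : linSubst (Matrix.diagonal fun _ : Fin n => c) f = c ^ m • f := by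
    ext d
    rw [coeff_linSubst_diagonal, coeff_smul, smul_eq_mul]
    by_cases hd : d.degree = m
    · rw [Finset.prod_pow_eq_pow_sum, ← hd, Finsupp.degree_eq_sum]
    · rw [hf.coeff_eq_zero hd, mul_zero, mul_zero]
  have h2 : c • A = A * Matrix.diagonal fun _ => c := by
    ext i j
    simp [mul_comm]
  rw [h2, linSubst_mul, AlgHom.comp_apply, h1, map_smul]

/-- The coefficients of the action of a matrix are polynomials in its entries. -/
theorem exists_eval_eq_linSubst (Φ : MvPolynomial (Fin n) ℂ →ₗ[ℂ] ℂ) (f : MvPolynomial (Fin n) ℂ) :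
    ∃ P : MvPolynomial (Fin n × Fin n) ℂ, ∀ A : Matrix (Fin n) (Fin n) ℂ,
      Φ (linSubst A f) = eval (fun ij => A ij.1 ij.2) P := by
  -- the substitution by the generic matrix
  let F : MvPolynomial (Fin n) (MvPolynomial (Fin n × Fin n) ℂ) :=
    aeval (fun j => ∑ i, C (X (i, j)) * X i) f
  have hF : ∀ A : Matrix (Fin n) (Fin n) ℂ,
      map (eval fun ij => A ij.1 ij.2) F = linSubst A f := by
    intro A
    simp only [F]
    induction f using MvPolynomial.induction_on with
    | C a =>
      rw [algHom_C, algHom_C, algebraMap_eq, MvPolynomial.algebraMap_apply, map_C,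
        algebraMap_eq, eval_C]
    | add p q hp hq => rw [map_add, map_add, map_add, hp, hq]
    | mul_X p j hp =>
      rw [map_mul, map_mul, map_mul, hp, aeval_X, linSubst_X]
      simp [smul_eq_C_mul]
  refine ⟨∑ d ∈ F.support, C (Φ (monomial d 1)) * coeff d F, fun A => ?_⟩
  rw [← hF A]
  conv_lhs => rw [F.as_sum]
  simp only [map_sum, map_monomial, map_mul, eval_C]
  refine Finset.sum_congr rfl fun d _ => ?_
  rw [← mul_one (eval _ (coeff d F)), ← smul_eq_mul, ← smul_monomial, map_smul, smul_eq_mul,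
    smul_eq_mul, mul_one, mul_comm]

/-- A matrix whose only nonzero row is `a` in position `i₀` evaluates forms at `a`, up to the factor
`X_{i₀} ^ m`. -/
theorem linSubst_single_row (a : Fin n → ℂ) (i₀ : Fin n) {m : ℕ} {f : MvPolynomial (Fin n) ℂ}
    (hf : f.IsHomogeneous m) :
    linSubst (Matrix.of fun i j => if i = i₀ then a j else 0) f = eval a f • X i₀ ^ m := by
  have hX : ∀ j, linSubst (Matrix.of fun i j => if i = i₀ then a j else 0) (X j) =
      C (a j) * X i₀ := by
    intro j
    simp [linSubst_X, ite_smul, smul_eq_C_mul]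
  rw [f.as_sum]
  simp only [map_sum, Finset.sum_smul]
  refine Finset.sum_congr rfl fun d hd => ?_
  have hdm : ∑ i, d i = m := by
    rw [← Finsupp.degree_eq_sum]
    by_contra h
    exact mem_support_iff.mp hd (hf.coeff_eq_zero h)
  rw [monomial_eq, map_mul, Finsupp.prod_fintype _ _ (by simp), map_prod, map_mul, map_prod]
  simp only [map_pow, hX, mul_pow, Finset.prod_mul_distrib, algHom_C, eval_C, eval_X,
    Finset.prod_pow_eq_pow_sum, hdm]
  rw [algebraMap_eq, smul_eq_C_mul]
  simp only [map_mul, map_prod, map_pow]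
  ring

theorem linSubst_X_pow_of_col (c : Fin n → ℂ) (j₀ : Fin n) (m : ℕ) :
    linSubst (Matrix.of fun i j => if j = j₀ then c i else 0) (X j₀ ^ m) = (∑ i, c i • X i) ^ m := by
  rw [map_pow, linSubst_X]
  simp

theorem mem_finsuppAntidiag_univ {d : Fin n →₀ ℕ} {m : ℕ} :
    d ∈ Finset.finsuppAntidiag Finset.univ m ↔ d.degree = m := by
  rw [Finset.mem_finsuppAntidiag, Finsupp.degree_eq_sum]
  simp

theorem sum_monomial_coeff {m : ℕ} {f : MvPolynomial (Fin n) ℂ} (hf : f.IsHomogeneous m) :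
    f = ∑ d ∈ Finset.finsuppAntidiag Finset.univ m, coeff d f • monomial d (1 : ℂ) := by
  ext e
  simp only [coeff_sum, coeff_smul, coeff_monomial, smul_eq_mul, mul_ite, mul_one, mul_zero,
    Finset.sum_ite_eq']
  split_ifs with h
  · rfl
  · exact hf.coeff_eq_zero fun h' => h (mem_finsuppAntidiag_univ.mpr h')

/-- The `m`-th powers of linear forms span the forms of degree `m`: a functional which vanishes
on the powers vanishes on all forms. -/
theorem eq_zero_of_forall_pow {m : ℕ} (Φ : MvPolynomial (Fin n) ℂ →ₗ[ℂ] ℂ)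
    (h : ∀ c : Fin n → ℂ, Φ ((∑ i, c i • X i) ^ m) = 0) {f : MvPolynomial (Fin n) ℂ}
    (hf : f.IsHomogeneous m) : Φ f = 0 := by
  let P : MvPolynomial (Fin n) ℂ := ∑ d ∈ Finset.finsuppAntidiag Finset.univ m,
    monomial d ((d.multinomial : ℂ) * Φ (monomial d 1))
  have hP : P = 0 := by
    refine MvPolynomial.funext fun c => ?_
    have hhom : ((∑ i, c i • X i : MvPolynomial (Fin n) ℂ) ^ m).IsHomogeneous m := by
      have : (∑ i, c i • X i : MvPolynomial (Fin n) ℂ).IsHomogeneous 1 :=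
        IsHomogeneous.sum _ _ _ fun i _ => by
          rw [smul_eq_C_mul]
          exact isHomogeneous_C_mul_X _ _
      simpa using this.pow m
    have h1 := h c
    rw [sum_monomial_coeff hhom, map_sum] at h1
    rw [map_zero, ← h1, map_sum]
    refine Finset.sum_congr rfl fun d hd => ?_
    have hd' : d.sum (fun _ k => k) = m := by
      rw [← mem_finsuppAntidiag_univ.mp hd, Finsupp.degree_eq_sum, Finsupp.sum_fintype _ _ (by simp)]
    -- the coefficients of a power of a linear form are multinomial coefficients, which are nonzero
    rw [map_smul, coeff_linearCombination_X_pow_of_fintype, if_pos hd', eval_monomial, smul_eq_mul]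
    ring
  have hmon : ∀ d ∈ Finset.finsuppAntidiag Finset.univ m, Φ (monomial d 1) = 0 := by
    intro d hd
    have h1 := congrArg (coeff d) hP
    simp only [P, coeff_sum, coeff_monomial, Finset.sum_ite_eq', coeff_zero] at h1
    rw [if_pos hd] at h1
    refine (mul_eq_zero.mp h1).resolve_left ?_
    exact_mod_cast (Nat.multinomial_pos _ _).ne'
  rw [sum_monomial_coeff hf, map_sum]
  exact Finset.sum_eq_zero fun d hd => by rw [map_smul, hmon d hd, smul_zero]

end Substitution

section SymmetricPower

open MvPolynomial

variable (r m : ℕ)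

/-- The `m`-th symmetric power of the standard representation of `SL(r+1, ℂ)`, realized on the
forms of degree `m` in `r + 1` variables. -/
def symPow : Representation ℂ (SLr r) (homogeneousSubmodule (Fin (r + 1)) ℂ m) where
  toFun g := (linSubst g.1).toLinearMap.restrict fun _ hf => isHomogeneous_linSubst g.1 hf
  map_one' := by
    ext1 f
    apply Subtype.ext
    change linSubst 1 f.1 = f.1
    rw [linSubst_one]
    rfl
  map_mul' g h := by
    ext1 f
    apply Subtype.ext
    change linSubst (g.1 * h.1) f.1 = linSubst g.1 (linSubst h.1 f.1)
    rw [linSubst_mul]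
    rfl

variable {r m}

theorem symPow_coe (g : SLr r) (f : homogeneousSubmodule (Fin (r + 1)) ℂ m) :
    (symPow r m g f : MvPolynomial (Fin (r + 1)) ℂ) = linSubst g.1 f.1 := rfl

theorem isAlgebraicRep_symPow : IsAlgebraicRep (symPow r m) := by
  intro φ f
  obtain ⟨Φ, hΦ⟩ := LinearMap.exists_extend φ
  obtain ⟨P, hP⟩ := exists_eval_eq_linSubst Φ f.1
  refine ⟨P, fun g => ?_⟩
  rw [← hP, ← hΦ]
  rfl

theorem hasHighestWeight_symPow :
    HasHighestWeight (symPow r m) (fun t => fundWeight r 1 t ^ m) := by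
  have hX : (X 0 ^ m : MvPolynomial (Fin (r + 1)) ℂ) ∈ homogeneousSubmodule (Fin (r + 1)) ℂ m :=
    isHomogeneous_X_pow 0 m
  refine ⟨⟨X 0 ^ m, hX⟩, ?_, fun u hu1 hu0 => ?_, fun t ht => ?_⟩
  · intro h
    exact pow_ne_zero m (X_ne_zero 0) (congrArg Subtype.val h)
  · apply Subtype.ext
    rw [symPow_coe, map_pow, linSubst_X, Finset.sum_eq_single 0]
    · rw [hu1, one_smul]
    · intro i _ hi
      rw [hu0 i 0 (Fin.pos_of_ne_zero hi), zero_smul]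
    · simp
  · apply Subtype.ext
    change linSubst (Matrix.diagonal t) (X 0 ^ m) = fundWeight r 1 t ^ m • X 0 ^ m
    rw [map_pow, linSubst_X, Finset.sum_eq_single 0]
    · rw [Matrix.diagonal_apply_eq, smul_pow, fundWeight_one]
    · intro i _ hi
      rw [Matrix.diagonal_apply_ne _ hi, zero_smul]
    · simp

/-- A subspace of the forms of degree `m` which is stable under `SL(r+1, ℂ)` is stable under
all matrices: scalars act by scalars, and invertible matrices are Zariski dense. -/
theorem linSubst_mem_of_invariant {W : Submodule ℂ (homogeneousSubmodule (Fin (r + 1)) ℂ m)}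
    (hW : ∀ g, ∀ f ∈ W, symPow r m g f ∈ W) (A : Matrix (Fin (r + 1)) (Fin (r + 1)) ℂ)
    {f : homogeneousSubmodule (Fin (r + 1)) ℂ m} (hf : f ∈ W) :
    (⟨linSubst A f.1, isHomogeneous_linSubst A f.2⟩ : homogeneousSubmodule (Fin (r + 1)) ℂ m) ∈
      W := by
  by_contra hA
  obtain ⟨φ, hφA, hφW⟩ := Submodule.exists_le_ker_of_notMem hA
  obtain ⟨Φ, hΦ⟩ := LinearMap.exists_extend φ
  have hΦ' : ∀ p : homogeneousSubmodule (Fin (r + 1)) ℂ m, Φ p.1 = φ p := fun p =>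
    LinearMap.congr_fun hΦ p
  obtain ⟨P, hP⟩ := exists_eval_eq_linSubst Φ f.1
  have hinv : ∀ B : Matrix (Fin (r + 1)) (Fin (r + 1)) ℂ, B.det ≠ 0 → Φ (linSubst B f.1) = 0 := by
    intro B hB
    obtain ⟨c, hc⟩ := IsAlgClosed.exists_pow_nat_eq B.det r.succ_pos
    have hc0 : c ≠ 0 := by
      rintro rfl
      rw [zero_pow r.succ_ne_zero] at hc
      exact hB hc.symm
    have hdet : (c⁻¹ • B).det = 1 := by
      rw [Matrix.det_smul, Fintype.card_fin, ← hc, ← mul_pow, inv_mul_cancel₀ hc0, one_pow]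
    have h1 := hφW (hW (toSL (c⁻¹ • B)) f hf)
    rw [LinearMap.mem_ker, ← hΦ', symPow_coe, toSL_val hdet] at h1
    rw [← smul_inv_smul₀ hc0 B, linSubst_smul c _ f.2, map_smul, h1, smul_zero]
  have hPdet : P * (Matrix.mvPolynomialX (Fin (r + 1)) (Fin (r + 1)) ℂ).det = 0 := by
    refine MvPolynomial.funext fun s => ?_
    rw [map_mul, Matrix.eval_det_mvPolynomialX, map_zero]
    by_cases hs : (Matrix.of fun i j => s (i, j)).det = 0
    · exact mul_eq_zero_of_right _ hs
    · have h1 := hinv _ hs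
      rw [hP] at h1
      exact mul_eq_zero_of_left h1 _
  have hP0 := (mul_eq_zero.mp hPdet).resolve_right (Matrix.det_mvPolynomialX_ne_zero _ _)
  apply hφA
  rw [← hΦ', hP, hP0, map_zero]

theorem isIrreducible_symPow : (symPow r m).IsIrreducible := by
  have hX : (X 0 ^ m : MvPolynomial (Fin (r + 1)) ℂ) ∈ homogeneousSubmodule (Fin (r + 1)) ℂ m :=
    isHomogeneous_X_pow 0 m
  have hX0 : (⟨X 0 ^ m, hX⟩ : homogeneousSubmodule (Fin (r + 1)) ℂ m) ≠ 0 := fun h =>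
    pow_ne_zero m (X_ne_zero 0) (congrArg Subtype.val h)
  have hnt : Nontrivial (Subrepresentation (symPow r m)) := by
    refine ⟨⊥, ⊤, fun h => hX0 ?_⟩
    have h1 : (⊥ : Submodule ℂ (homogeneousSubmodule (Fin (r + 1)) ℂ m)) = ⊤ :=
      congrArg Subrepresentation.toSubmodule h
    rw [← Submodule.mem_bot ℂ, h1]
    exact Submodule.mem_top
  refine { hnt with eq_bot_or_eq_top := fun W => ?_ }
  by_cases hbot : W.toSubmodule = ⊥
  · exact Or.inl (Subrepresentation.toSubmodule_injective hbot)
  right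
  apply Subrepresentation.toSubmodule_injective
  change W.toSubmodule = ⊤
  have hW : ∀ g, ∀ f ∈ W.toSubmodule, symPow r m g f ∈ W.toSubmodule := fun g f hf =>
    W.apply_mem_toSubmodule g hf
  obtain ⟨w, hw, hw0⟩ := Submodule.exists_mem_ne_zero_of_ne_bot hbot
  -- a matrix of rank one maps `w` to a nonzero multiple of `X_0 ^ m`
  obtain ⟨a, ha⟩ : ∃ a, eval a w.1 ≠ 0 := by
    by_contra! h
    exact hw0 (Subtype.ext (MvPolynomial.funext fun a => by rw [h a]; simp))
  have hXW : (⟨X 0 ^ m, hX⟩ : homogeneousSubmodule (Fin (r + 1)) ℂ m) ∈ W.toSubmodule := by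
    have h1 := linSubst_mem_of_invariant hW (Matrix.of fun i j => if i = 0 then a j else 0) hw
    have h2 := W.toSubmodule.smul_mem (eval a w.1)⁻¹ h1
    convert h2 using 1
    apply Subtype.ext
    change X 0 ^ m = (eval a w.1)⁻¹ • linSubst _ w.1
    rw [linSubst_single_row a 0 w.2, inv_smul_smul₀ ha]
  by_contra htop
  obtain ⟨f, -, hf⟩ := SetLike.exists_of_lt (lt_top_iff_ne_top.mpr htop)
  obtain ⟨φ, hφf, hφW⟩ := Submodule.exists_le_ker_of_notMem hf
  obtain ⟨Φ, hΦ⟩ := LinearMap.exists_extend φ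
  have hΦ' : ∀ p : homogeneousSubmodule (Fin (r + 1)) ℂ m, Φ p.1 = φ p := fun p =>
    LinearMap.congr_fun hΦ p
  apply hφf
  rw [← hΦ']
  refine eq_zero_of_forall_pow Φ (fun c => ?_) f.2
  have h1 := hφW (linSubst_mem_of_invariant hW
    (Matrix.of fun i j => if j = 0 then c i else 0) hXW)
  rw [LinearMap.mem_ker, ← hΦ'] at h1
  rw [← linSubst_X_pow_of_col c 0 m]
  exact h1

theorem isIrrepOfHighestWeight_symPow :
    IsIrrepOfHighestWeight (symPow r m) (fun t => fundWeight r 1 t ^ m) where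
  finiteDimensional := Module.Finite.iff_fg.mpr (homogeneousSubmodule_fg _ _ m)
  irreducible := isIrreducible_symPow
  algebraic := isAlgebraicRep_symPow
  highestWeight := hasHighestWeight_symPow

theorem restrictSupport_finsuppAntidiag {n : ℕ} (m : ℕ) :
    restrictSupport ℂ ((Finset.finsuppAntidiag Finset.univ m : Finset (Fin n →₀ ℕ)) : Set _) =
      homogeneousSubmodule (Fin n) ℂ m := by
  rw [homogeneousSubmodule_eq_finsupp_supported, restrictSupport]
  congr 1
  ext d
  exact mem_finsuppAntidiag_univ

theorem character_symPow (g : Fin (r + 1) → ℂ) {G : SLr r} (hG : G.1 = Matrix.diagonal g) :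
    (symPow r m).character G = hsum g m := by
  obtain ⟨b, hrepr⟩ : ∃ b : Module.Basis
      (Finset.finsuppAntidiag (Finset.univ : Finset (Fin (r + 1))) m) ℂ
      (homogeneousSubmodule (Fin (r + 1)) ℂ m), ∀ f d, b.repr f d = coeff d.1 f.1 :=
    ⟨(basisRestrictSupport ℂ _).map (LinearEquiv.ofEq _ _ (restrictSupport_finsuppAntidiag m)),
      fun _ _ => rfl⟩
  calc (symPow r m).character G = ∑ d, b.repr (symPow r m G (b d)) d := by
        rw [Representation.character, LinearMap.trace_eq_matrix_trace ℂ b]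
        simp only [Matrix.trace, Matrix.diag_apply, LinearMap.toMatrix_apply]
    _ = ∑ d : Finset.finsuppAntidiag (Finset.univ : Finset (Fin (r + 1))) m, ∏ i, g i ^ d.1 i := by
        refine Finset.sum_congr rfl fun d _ => ?_
        rw [hrepr, symPow_coe, hG, coeff_linSubst_diagonal, ← hrepr, b.repr_self,
          Finsupp.single_eq_same, mul_one]
    _ = hsum g m := Finset.sum_coe_sort _ fun d : Fin (r + 1) →₀ ℕ => ∏ i, g i ^ d i

end SymmetricPower

/-- The character of an irreducible algebraic representation is determined by its highest weight,
here for the weights `m λ_1`. -/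
theorem character_eq_of_isIrrepOfHighestWeight {r m : ℕ} {V W : Type*} [AddCommGroup V]
    [Module ℂ V] [AddCommGroup W] [Module ℂ W] {ρ : Representation ℂ (SLr r) V}
    {σ : Representation ℂ (SLr r) W}
    (hρ : IsIrrepOfHighestWeight ρ (fun t => fundWeight r 1 t ^ m))
    (hσ : IsIrrepOfHighestWeight σ (fun t => fundWeight r 1 t ^ m)) (g : SLr r) :
    ρ.character g = σ.character g := by
  obtain ⟨v, hv, hvU, hvT⟩ := hρ.highestWeight
  obtain ⟨w, hw, hwU, hwT⟩ := hσ.highestWeight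
  obtain ⟨l, hl⟩ := exists_functional_matrixCoeff hρ.algebraic hv hvU hvT
  obtain ⟨k, hk⟩ := exists_functional_matrixCoeff hσ.algebraic hw hwU hwT
  refine character_eq_of_matrixCoeff_eq hρ.irreducible hσ.irreducible
    (fun h => (hl h).trans (hk h).symm) ?_ g
  have h1 := hl 1
  rw [map_one, Module.End.one_apply] at h1
  rw [h1]
  change (1 : Matrix (Fin (r + 1)) (Fin (r + 1)) ℂ) 0 0 ^ m ≠ 0
  simp

end HirotaA

end

theorem theorem4 (r : ℕ) (hr : 1 ≤ r) (z : HirotaA.Vert r → ℂ) (hz : z ∈ HirotaA.S r)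
    (g : Fin (r + 1) → ℂ)
    (hg : (HirotaA.charPoly z).roots = Multiset.map g Finset.univ.val) :
    ∃ hdet : (Matrix.diagonal g).det = 1, ∀ m : ℕ,
      (∃ (V : Type) (_ : AddCommGroup V) (_ : Module ℂ V)
        (ρ : Representation ℂ (HirotaA.SLr r) V),
        HirotaA.IsIrrepOfHighestWeight ρ (fun t => HirotaA.fundWeight r 1 t ^ m)) ∧
      ∀ (V : Type*) [AddCommGroup V] [Module ℂ V] (ρ : Representation ℂ (HirotaA.SLr r) V),
        HirotaA.IsIrrepOfHighestWeight ρ (fun t => HirotaA.fundWeight r 1 t ^ m) →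
        HirotaA.comp z 1 m = ρ.character (⟨Matrix.diagonal g, hdet⟩ : HirotaA.SLr r) := by
  have hdet : (Matrix.diagonal g).det = 1 := by
    rw [Matrix.det_diagonal, HirotaA.prod_roots_charPoly z hg]
  refine ⟨hdet, fun m => ⟨⟨_, _, _, HirotaA.symPow r m,
    HirotaA.isIrrepOfHighestWeight_symPow⟩, fun V _ _ ρ hρ => ?_⟩⟩
  exact (HirotaA.comp_one_eq_hsum hz hr hg m).trans
    ((HirotaA.character_eq_of_isIrrepOfHighestWeight hρ HirotaA.isIrrepOfHighestWeight_symPow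
      _).trans (HirotaA.character_symPow g rfl)).symm
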